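/- Let $n\ge 2$ be an integer and let $\mathcal D_n$ be the dihedral group of order $2n$ acting on $\mathbb R^2=\mathbb C$: with $w=e^{i\pi/n}$ it consists of the rotations $z\mapsto w^{2j}z$ and the reflections $z\mapsto w^{2j}\overline z$, $j=0,\dots,n-1$, the latter being the reflections $\sigma_\alpha$ in the positive roots $\alpha\in R_+=\{iw^j: j=0,\dots,n-1\}$. Let $\langle\cdot,\cdot\rangle$ be the canonical inner product of $\mathbb R^2$, extended to a $\mathbb C$-bilinear form on $\mathbb C^2$. Let $k\in\mathbb C$, put $\gamma=nk$, and assume that $\gamma\notin\{-m/2 : m=1,2,3,\dots\}$. For $\xi\in\mathbb R^2$ let $$T_\xi f(x)=\partial_\xi f(x)+k\sum_{\alpha\in R_+}\langle\alpha,\xi\rangle\frac{f(x)-f(\sigma_\alpha x)}{\langle\alpha,x\rangle}$$ be the Dunkl operator with constant parameter $k$ (for $\langle\alpha,x\rangle=0$ the quotient stands for its limit $2\,\partial_\alpha f(x)/|\alpha|^2$), and let $E_k:\mathbb R^2\times\mathbb C^2\to\mathbb C$ be the Dunkl kernel, that is, the function, real-analytic in $x$, with $E_k(0,y)=1$ and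 $T_\xi E_k(\cdot,y)=\langle\xi,y\rangle E_k(\cdot,y)$ for all $\xi\in\mathbb R^2$ and $y\in\mathbb C^2$. Put $a(x,y)=\max_{g\in\mathcal D_n}|\langle gx,y\rangle|$. Let $\nu$ be a positive integer with $\mathrm{Re}(\gamma)>-\nu$. Then $E_k$ exists and is unique, and there are a constant $\delta\ge 1$ and a constant $C=C(n,k,\nu)>0$, neither depending on $x$ or $y$, such that $$|E_k(x,y)|\le C\,(\delta a(x,y)+1)^{\nu+2}\,e^{\delta a(x,y)}\qquad\text{for all }x\in\mathbb R^2,\ y\in\mathbb C^2.$$ -/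

import Mathlib

open scoped RealInnerProductSpace

noncomputable section

namespace DihedralDunkl

/-- The Euclidean plane `ℝ²`. -/
abbrev Plane : Type := EuclideanSpace ℝ (Fin 2)

/-- The space `ℂ²`. -/
abbrev CPlane : Type := EuclideanSpace ℂ (Fin 2)

/-- The bilinear (not sesquilinear) extension of the canonical inner product,
`⟨x, y⟩ = x₀ y₀ + x₁ y₁`, for `x ∈ ℝ²` and `y ∈ ℂ²`. -/
def pairing (x : Plane) (y : CPlane) : ℂ :=
  (x 0 : ℂ) * y 0 + (x 1 : ℂ) * y 1

/-- The reflection `σ_α (x) = x - 2 ⟨x, α⟩ α / |α|²`. -/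
def reflect (α x : Plane) : Plane :=
  x - (2 * ⟪x, α⟫ / ‖α‖ ^ 2) • α

/-- The positive roots `i w ^ j`, `w = exp (i π / n)`, `j = 0, …, n - 1`, of the dihedral group
of order `2 n`, under the identification `ℂ = ℝ²`. -/
def root (n j : ℕ) : Plane :=
  !₂[-Real.sin (Real.pi * j / n), Real.cos (Real.pi * j / n)]

/-- The rotation `z ↦ w ^ (2 j) z`, `w = exp (i π / n)`, that is, the rotation of angle
`2 π j / n`. -/
def rotate (n j : ℕ) (x : Plane) : Plane :=
  !₂[Real.cos (2 * Real.pi * j / n) * x 0 - Real.sin (2 * Real.pi * j / n) * x 1,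
     Real.sin (2 * Real.pi * j / n) * x 0 + Real.cos (2 * Real.pi * j / n) * x 1]

/-- The dihedral group `D_n` of order `2 n`, as a set of maps of the plane: the `n` rotations of
angles `2 π j / n`, and the `n` reflections in the roots. -/
def dihedral (n : ℕ) : Set (Plane → Plane) :=
  {g | ∃ j < n, g = rotate n j} ∪ {g | ∃ j < n, g = reflect (root n j)}

/-- `a (x, y)`, the maximum of `|⟨g x, y⟩|` over the finite set of all `g ∈ D_n`. -/
def orbitMax (n : ℕ) (x : Plane) (y : CPlane) : ℝ :=
  ⨆ g : dihedral n, ‖pairing (g.1 x) y‖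

open Classical in
/-- The difference quotient `(f (x) - f (σ_α x)) / ⟨α, x⟩` of a `C¹` function `f`.
On the line `⟨α, x⟩ = 0` it has its limit value `(2 / |α|²) ∂_α f (x)`. -/
def diffQuot (α : Plane) (f : Plane → ℂ) (x : Plane) : ℂ :=
  if ⟪α, x⟫ = 0 then ((2 / ‖α‖ ^ 2 : ℝ) : ℂ) * fderiv ℝ f x α
  else (f x - f (reflect α x)) / ((⟪α, x⟫ : ℝ) : ℂ)

/-- The Dunkl operator `T_ξ (k)` of the dihedral group `D_n` with constant parameter `k`. -/
def dunklOp (n : ℕ) (k : ℂ) (ξ : Plane) (f : Plane → ℂ) (x : Plane) : ℂ :=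
  fderiv ℝ f x ξ +
    ∑ j ∈ Finset.range n, k * ((⟪root n j, ξ⟫ : ℝ) : ℂ) * diffQuot (root n j) f x

/-- `E` solves the eigenvalue problem that characterizes the Dunkl kernel:
`x ↦ E (x, y)` is real-analytic on `ℝ²`, `E (0, y) = 1`, and
`T_ξ E (·, y) = ⟨ξ, y⟩ E (·, y)` for all `ξ ∈ ℝ²` and `y ∈ ℂ²`. -/
structure IsDunklKernel (n : ℕ) (k : ℂ) (E : Plane → CPlane → ℂ) : Prop where
  analytic : ∀ y, AnalyticOnNhd ℝ (fun x => E x y) Set.univ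
  map_zero : ∀ y, E 0 y = 1
  eigen : ∀ y ξ x, dunklOp n k ξ (fun z => E z y) x = pairing ξ y * E x y

/-- The Dunkl kernel `E_k`: the solution of the eigenvalue problem `IsDunklKernel`. -/
def dunklKernel (n : ℕ) (k : ℂ) : Plane → CPlane → ℂ :=
  Classical.epsilon (IsDunklKernel n k)

end DihedralDunkl

end

/-! Expand the kernel into homogeneous components `E_m` in `x`. Taking `ξ = x` in the eigenvalue
equation cancels all denominators, and with Euler's identity the part of degree `m` reads `(m + nk)
E_m - k A E_m = ⟨x, y⟩ E_{m-1}`, where `A f = ∑ f ∘ σ_α`. A product of three dihedral reflections is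
again a reflection, so `A³ = n² A`. Hence `μ - kA` has an explicit inverse as soon as `μ ≠ 0` and
`μ² ≠ (nk)²`; for `μ = m + nk` these are conditions on `m + nk` and `m (m + 2nk)`, guaranteed by the
assumption on `γ = nk`.

The inverse has sup-norm at most `δ / m` on functions on an orbit (`exists_resolventBound_le`), so
the recursion gives `|E_m| ≤ (δ a)^m / m!` (`norm_dunklTerm_le`). Summing, `|E_k| ≤ exp (δ a)`; the
polynomial factor is at least 1 and `C = 1` suffices.

The recursion only encodes the radial equation. The equations for all `ξ` follow from commutativity
of the Dunkl operators (`dunklOp_comm`): the defect `T_ξ E_{m+1} - ⟨ξ, y⟩ E_m` lies in the kernel of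
an operator `μ - kA`, now with the reflections acting on pairs `(ξ, x)` (`dunklOp_eq_of_self`).
Uniqueness applies the same kernel statement to Taylor coefficients along rays
(`eq_zero_of_radial`). -/

open scoped RealInnerProductSpace

noncomputable section

namespace DihedralDunkl

/-! ### Inverting `μ - k A`, with `A` the sum over reflections -/

section Resolvent

variable {n : ℕ} [NeZero n] {X : Type*} {r : ZMod n → X → X}

/-- This is `A³ = n² A`: with two of the three reflections fixed, the product runs once through all
reflections. The set `X` is left abstract because it will be the plane, pairs of points and tuples
of vectors. -/
lemma sum_triple (hr : ∀ a b c x, r a (r b (r c x)) = r (a - b + c) x) (f : X → ℂ) (x : X) :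
    ∑ a, ∑ b, ∑ c, f (r c (r b (r a x))) = (n : ℂ) ^ 2 * ∑ a, f (r a x) := by
  have h : ∀ a b : ZMod n, ∑ c, f (r c (r b (r a x))) = ∑ c, f (r c x) := by
    intro a b
    rw [← Equiv.sum_comp (Equiv.addRight (a - b)) (fun c => f (r c x))]
    refine Finset.sum_congr rfl fun c _ => ?_
    rw [hr, Equiv.coe_addRight]
    congr 2
    ring
  simp only [h, Finset.sum_const, Finset.card_univ, ZMod.card, nsmul_eq_mul]
  ring

/-- The kernel of `μ - k ∑ r a` is trivial unless `μ ∈ {0, n k, -n k}`. -/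
lemma eq_zero_of_mul_eq_sum (hr : ∀ a b c x, r a (r b (r c x)) = r (a - b + c) x)
    {k μ : ℂ} (hμ : μ ≠ 0) (hμ' : μ ^ 2 ≠ (n * k) ^ 2) {f : X → ℂ}
    (h : ∀ x, μ * f x = k * ∑ a, f (r a x)) (x : X) : f x = 0 := by
  have h1 : μ * ∑ a, f (r a x) = k * ∑ a, ∑ b, f (r b (r a x)) := by
    rw [Finset.mul_sum, Finset.mul_sum]
    exact Finset.sum_congr rfl fun a _ => h _
  have h2 : μ * ∑ a, ∑ b, f (r b (r a x)) = k * ((n : ℂ) ^ 2 * ∑ a, f (r a x)) := by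
    rw [← sum_triple hr, Finset.mul_sum, Finset.mul_sum]
    refine Finset.sum_congr rfl fun a _ => ?_
    rw [Finset.mul_sum, Finset.mul_sum]
    exact Finset.sum_congr rfl fun b _ => h _
  have h3 : (μ ^ 2 - (n * k) ^ 2) * ∑ a, f (r a x) = 0 := by
    linear_combination μ * h1 + k * h2
  have h4 : ∑ a, f (r a x) = 0 :=
    (mul_eq_zero.1 h3).resolve_left (sub_ne_zero.2 hμ')
  have h5 := h x
  rw [h4, mul_zero] at h5
  exact (mul_eq_zero.1 h5).resolve_left hμ

variable (r) in
/-- The inverse of the operator `μ - k ∑ r a` on functions. -/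
def resolvent (k μ : ℂ) (f : X → ℂ) (x : X) : ℂ :=
  μ⁻¹ * f x + k / (μ ^ 2 - (n * k) ^ 2) * ∑ a, f (r a x) +
    k ^ 2 / (μ * (μ ^ 2 - (n * k) ^ 2)) * ∑ a, ∑ b, f (r b (r a x))

/-- The coefficients come from summing the formal geometric series `∑ k^j A^j / μ^(j+1)`, whose odd
and even parts collapse by `A³ = n² A`. -/
lemma resolvent_spec (hr : ∀ a b c x, r a (r b (r c x)) = r (a - b + c) x)
    {k μ : ℂ} (hμ : μ ≠ 0) (hμ' : μ ^ 2 ≠ (n * k) ^ 2) (f : X → ℂ) (x : X) :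
    μ * resolvent r k μ f x - k * ∑ a, resolvent r k μ f (r a x) = f x := by
  have h' := sub_ne_zero.2 hμ'
  simp only [resolvent, Finset.sum_add_distrib, ← Finset.mul_sum]
  rw [sum_triple hr]
  generalize ∑ a, f (r a x) = S, ∑ a, ∑ b, f (r b (r a x)) = S'
  obtain ⟨D, hD⟩ : ∃ D, D = μ ^ 2 - (n * k) ^ 2 := ⟨_, rfl⟩
  rw [← hD] at h' ⊢
  field_simp
  linear_combination -k * S * hD

/-- A bound for the norm of `resolvent r k μ` with respect to the supremum norm. -/
def resolventBound (n : ℕ) (k μ : ℂ) : ℝ :=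
  ‖μ⁻¹‖ + n * ‖k / (μ ^ 2 - (n * k) ^ 2)‖ + n ^ 2 * ‖k ^ 2 / (μ * (μ ^ 2 - (n * k) ^ 2))‖

/-- Only the points that the resolvent samples enter, so `B` may depend on the orbit of `x`. -/
lemma norm_resolvent_le {k μ : ℂ} {f : X → ℂ} {x : X} {B : ℝ} (h₀ : ‖f x‖ ≤ B)
    (h₁ : ∀ a, ‖f (r a x)‖ ≤ B) (h₂ : ∀ a b, ‖f (r b (r a x))‖ ≤ B) :
    ‖resolvent r k μ f x‖ ≤ resolventBound n k μ * B := by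
  have e1 : ‖∑ a, f (r a x)‖ ≤ n * B := by
    refine (norm_sum_le_of_le _ fun a _ => h₁ a).trans_eq ?_
    simp [ZMod.card]
  have e2 : ‖∑ a, ∑ b, f (r b (r a x))‖ ≤ n * (n * B) := by
    refine (norm_sum_le_of_le _ fun a _ => norm_sum_le_of_le _ fun b _ => h₂ a b).trans_eq ?_
    simp [ZMod.card]
  calc ‖resolvent r k μ f x‖
      ≤ ‖μ⁻¹‖ * ‖f x‖ + ‖k / (μ ^ 2 - (n * k) ^ 2)‖ * ‖∑ a, f (r a x)‖ +
        ‖k ^ 2 / (μ * (μ ^ 2 - (n * k) ^ 2))‖ * ‖∑ a, ∑ b, f (r b (r a x))‖ := by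
        simp only [← norm_mul]
        exact norm_add₃_le
    _ ≤ ‖μ⁻¹‖ * B + ‖k / (μ ^ 2 - (n * k) ^ 2)‖ * (n * B) +
        ‖k ^ 2 / (μ * (μ ^ 2 - (n * k) ^ 2))‖ * (n * (n * B)) := by gcongr
    _ = _ := by rw [resolventBound]; ring

/-- `m / (m + z)` converges to 1, hence is bounded. No condition on `z` is needed, since a vanishing
denominator gives `0⁻¹ = 0`. -/
lemma exists_norm_inv_le (z : ℂ) :
    ∃ C : ℝ, ∀ m : ℕ, 1 ≤ m → ‖((m : ℂ) + z)⁻¹‖ ≤ C / m := by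
  have h1 : Filter.Tendsto (fun m : ℕ => (m : ℂ) / ((m : ℂ) + z)) Filter.atTop (nhds 1) :=
    tendsto_natCast_div_add_atTop z
  obtain ⟨C, hC⟩ := (Metric.isBounded_range_of_tendsto _ h1).exists_norm_le
  refine ⟨C, fun m hm => ?_⟩
  have := hC _ ⟨m, rfl⟩
  have hm' : (0 : ℝ) < m := by exact_mod_cast hm
  rw [le_div_iff₀ hm']
  simpa [div_eq_inv_mul] using this

/-- For `μ = m + nk` one has `μ² - (nk)² = m (m + 2nk)`, so each of the three coefficients is
`O(1/m)`. The decay `1/m` is what builds the factorial in the estimate of the components. -/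
lemma exists_resolventBound_le (n : ℕ) (k : ℂ) :
    ∃ δ : ℝ, 1 ≤ δ ∧ ∀ m : ℕ, 1 ≤ m → resolventBound n k (m + n * k) ≤ δ / m := by
  obtain ⟨C, hC⟩ := exists_norm_inv_le (n * k)
  obtain ⟨D, hD⟩ := exists_norm_inv_le (2 * (n * k))
  have C0 : 0 ≤ C := by simpa using (norm_nonneg _).trans (hC 1 le_rfl)
  have D0 : 0 ≤ D := by simpa using (norm_nonneg _).trans (hD 1 le_rfl)
  refine ⟨max 1 (C + n * (‖k‖ * D) + n ^ 2 * (‖k‖ ^ 2 * (C * D))), le_max_left _ _, ?_⟩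
  intro m hm
  have hm' : (1 : ℝ) ≤ m := by exact_mod_cast hm
  have hm0 : (0 : ℝ) < m := by linarith
  have e : ((m : ℂ) + n * k) ^ 2 - (n * k) ^ 2 = m * (m + 2 * (n * k)) := by ring
  have hle : ∀ x : ℝ, 0 ≤ x → x / m ≤ x := fun x hx => div_le_self hx hm'
  have b2 : ‖k / (((m : ℂ) + n * k) ^ 2 - (n * k) ^ 2)‖ ≤ (‖k‖ * D) / m := by
    rw [e, div_eq_mul_inv, mul_inv, norm_mul, norm_mul, norm_inv, Complex.norm_natCast,
      mul_div_assoc]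
    gcongr
    calc (m : ℝ)⁻¹ * ‖((m : ℂ) + 2 * (n * k))⁻¹‖ ≤ 1 * (D / m) := by
          gcongr
          · exact inv_le_one_of_one_le₀ hm'
          · exact hD m hm
      _ = D / m := one_mul _
  have b3 : ‖k ^ 2 / (((m : ℂ) + n * k) * (((m : ℂ) + n * k) ^ 2 - (n * k) ^ 2))‖ ≤
      (‖k‖ ^ 2 * (C * D)) / m := by
    rw [e, div_eq_mul_inv, mul_inv, mul_inv, norm_mul, norm_mul, norm_mul, norm_pow,
      norm_inv (m : ℂ), Complex.norm_natCast, mul_div_assoc]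
    gcongr
    calc ‖((m : ℂ) + n * k)⁻¹‖ * ((m : ℝ)⁻¹ * ‖((m : ℂ) + 2 * (n * k))⁻¹‖)
        ≤ C * (1 * (D / m)) := by
          gcongr
          · exact (hC m hm).trans (hle C C0)
          · exact inv_le_one_of_one_le₀ hm'
          · exact hD m hm
      _ = C * D / m := by ring
  calc resolventBound n k (m + n * k)
      ≤ C / m + n * ((‖k‖ * D) / m) + n ^ 2 * ((‖k‖ ^ 2 * (C * D)) / m) := by
        unfold resolventBound
        gcongr
        exact hC m hm
    _ = (C + n * (‖k‖ * D) + n ^ 2 * (‖k‖ ^ 2 * (C * D))) / m := by ring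
    _ ≤ _ := by gcongr; exact le_max_right _ _

end Resolvent

/-! ### Reflections and roots in complex coordinates -/

section Geometry

/-- The plane as the complex line. -/
def toComplex (x : Plane) : ℂ := ⟨x 0, x 1⟩

lemma toComplex_injective : Function.Injective toComplex := by
  intro x y h
  have h' := Complex.ext_iff.1 h
  ext i
  fin_cases i
  · exact h'.1
  · exact h'.2

lemma inner_eq (x y : Plane) : ⟪x, y⟫ = x 0 * y 0 + x 1 * y 1 := by
  simp [PiLp.inner_apply, Fin.sum_univ_two]
  ring

lemma norm_root (n j : ℕ) : ‖root n j‖ = 1 := by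
  rw [EuclideanSpace.norm_eq, Fin.sum_univ_two]
  simp [root]

/-- The reflection `reflect α` as a continuous linear map. -/
def reflectL (α : Plane) : Plane →L[ℝ] Plane :=
  .id ℝ Plane - (2 / ‖α‖ ^ 2) • (innerSL ℝ α).smulRight α

lemma reflectL_apply (α x : Plane) : reflectL α x = reflect α x := by
  simp only [reflectL, reflect, sub_apply, smul_apply,
    ContinuousLinearMap.id_apply, ContinuousLinearMap.smulRight_apply, innerSL_apply_apply,
    smul_smul, real_inner_comm x α]
  congr 2
  ring

variable {n : ℕ}

variable (n) in
/-- The positive roots, indexed by `ℤ / n`. -/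
def zroot (a : ZMod n) : Plane := root n a.val

variable (n) in
/-- The reflections in the positive roots, indexed by `ℤ / n`. -/
def refl (a : ZMod n) : Plane →L[ℝ] Plane := reflectL (zroot n a)

@[simp] lemma norm_zroot (a : ZMod n) : ‖zroot n a‖ = 1 := norm_root _ _

lemma refl_apply (a : ZMod n) (x : Plane) : refl n a x = x - (2 * ⟪zroot n a, x⟫) • zroot n a := by
  simp [refl, reflectL_apply, reflect, real_inner_comm]

lemma reflect_zroot (a : ZMod n) (x : Plane) : reflect (zroot n a) x = refl n a x := by
  rw [refl, reflectL_apply]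

lemma sum_range_eq_sum_zmod [NeZero n] {M : Type*} [AddCommMonoid M] (F : ℕ → M) :
    ∑ j ∈ Finset.range n, F j = ∑ a : ZMod n, F a.val := by
  refine Finset.sum_nbij' (fun j => (j : ZMod n)) (fun a => a.val) ?_ ?_ ?_ ?_ ?_
  · simp
  · intro a _
    simpa using ZMod.val_lt a
  · intro j hj
    exact ZMod.val_natCast_of_lt (Finset.mem_range.1 hj)
  · intro a _
    exact ZMod.natCast_zmod_val a
  · intro j hj
    rw [ZMod.val_natCast_of_lt (Finset.mem_range.1 hj)]

lemma stdAddChar_eq [NeZero n] (a : ZMod n) : (ZMod.stdAddChar a : ℂ) =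
    ⟨Real.cos (2 * Real.pi * a.val / n), Real.sin (2 * Real.pi * a.val / n)⟩ := by
  have h := ZMod.stdAddChar_coe (N := n) (a.val : ℤ)
  rw [Int.cast_natCast, ZMod.natCast_zmod_val] at h
  rw [h]
  have e : (2 * Real.pi * Complex.I * ((a.val : ℤ) : ℂ) / n : ℂ) =
      ((2 * Real.pi * a.val / n : ℝ) : ℂ) * Complex.I := by
    push_cast; ring
  rw [e]
  apply Complex.ext
  · rw [Complex.exp_ofReal_mul_I_re]
  · rw [Complex.exp_ofReal_mul_I_im]

lemma conj_stdAddChar [NeZero n] (a : ZMod n) :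
    (starRingEnd ℂ) (ZMod.stdAddChar a) = ZMod.stdAddChar (-a) := by
  rw [AddChar.map_neg_eq_conj]

lemma toComplex_refl [NeZero n] (a : ZMod n) (x : Plane) :
    toComplex (refl n a x) = ZMod.stdAddChar a * (starRingEnd ℂ) (toComplex x) := by
  have h2 : 2 * Real.pi * a.val / n = 2 * (Real.pi * a.val / n) := by ring
  rw [refl_apply, stdAddChar_eq, h2, Real.cos_two_mul, Real.sin_two_mul, inner_eq]
  have hs := Real.sin_sq_add_cos_sq (Real.pi * a.val / n)
  apply Complex.ext
  · simp [toComplex, zroot, root, -ZMod.natCast_val]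
    linear_combination -2 * x 0 * hs
  · simp [toComplex, zroot, root, -ZMod.natCast_val]
    linear_combination

lemma toComplex_rotate [NeZero n] (a : ZMod n) (x : Plane) :
    toComplex (rotate n a.val x) = ZMod.stdAddChar a * toComplex x := by
  rw [stdAddChar_eq]
  apply Complex.ext
  · simp [toComplex, rotate]
  · simp [toComplex, rotate]; ring

/-- In complex form `σ_a z = w^(2a) z̄`, so exponents add with alternating signs. Indexing by `ZMod
n` absorbs the periodicity of `w²`. -/
lemma refl_refl_refl [NeZero n] (a b c : ZMod n) (x : Plane) :
    refl n a (refl n b (refl n c x)) = refl n (a - b + c) x := by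
  apply toComplex_injective
  simp only [toComplex_refl, map_mul, Complex.conj_conj, conj_stdAddChar, neg_neg]
  rw [AddChar.map_add_eq_mul, sub_eq_add_neg, AddChar.map_add_eq_mul]
  ring

lemma refl_refl [NeZero n] (a b : ZMod n) (x : Plane) :
    refl n a (refl n b x) = rotate n (a - b).val x := by
  apply toComplex_injective
  simp only [toComplex_refl, toComplex_rotate, map_mul, Complex.conj_conj, conj_stdAddChar]
  rw [sub_eq_add_neg, AddChar.map_add_eq_mul]
  ring

lemma rotate_refl [NeZero n] (a b : ZMod n) (x : Plane) :
    rotate n a.val (refl n b x) = refl n (a + b) x := by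
  apply toComplex_injective
  simp only [toComplex_refl, toComplex_rotate]
  rw [AddChar.map_add_eq_mul]
  ring

lemma refl_self [NeZero n] (a : ZMod n) (x : Plane) : refl n a (refl n a x) = x := by
  apply toComplex_injective
  simp only [toComplex_refl, map_mul, Complex.conj_conj, conj_stdAddChar]
  rw [← mul_assoc, ← AddChar.map_add_eq_mul]
  simp

lemma inner_refl_refl (a : ZMod n) (x y : Plane) : ⟪refl n a x, refl n a y⟫ = ⟪x, y⟫ := by
  simp only [refl_apply, inner_sub_left, inner_sub_right, inner_smul_left, inner_smul_right,
    real_inner_self_eq_norm_sq, norm_zroot, real_inner_comm (zroot n a)]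
  simp
  ring

lemma norm_refl (a : ZMod n) (x : Plane) : ‖refl n a x‖ = ‖x‖ := by
  rw [norm_eq_sqrt_real_inner, inner_refl_refl, ← norm_eq_sqrt_real_inner]

lemma toComplex_zroot_sq [NeZero n] (a : ZMod n) :
    toComplex (zroot n a) ^ 2 = -ZMod.stdAddChar a := by
  have h2 : 2 * Real.pi * a.val / n = 2 * (Real.pi * a.val / n) := by ring
  have hs := Real.sin_sq_add_cos_sq (Real.pi * a.val / n)
  rw [stdAddChar_eq, h2, Real.cos_two_mul, Real.sin_two_mul]
  apply Complex.ext
  · simp [toComplex, zroot, root, pow_two, -ZMod.natCast_val]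
    linear_combination hs
  · simp [toComplex, zroot, root, pow_two, -ZMod.natCast_val]
    ring

/-- The square of a root is `-w^(2b)`, a character of `ZMod n`; comparing squares determines the
root up to sign without tracking when an index wraps around. -/
lemma refl_zroot [NeZero n] (a b : ZMod n) :
    refl n a (zroot n b) = zroot n (a - b + a) ∨ refl n a (zroot n b) = -zroot n (a - b + a) := by
  have h : toComplex (refl n a (zroot n b)) ^ 2 = toComplex (zroot n (a - b + a)) ^ 2 := by
    rw [toComplex_zroot_sq, toComplex_refl, mul_pow, ← map_pow (starRingEnd ℂ), toComplex_zroot_sq, map_neg,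
      conj_stdAddChar, AddChar.map_add_eq_mul, sub_eq_add_neg, AddChar.map_add_eq_mul]
    ring
  have hneg : ∀ x, -toComplex x = toComplex (-x) := fun x => by
    apply Complex.ext <;> simp [toComplex]
  rcases sq_eq_sq_iff_eq_or_eq_neg.1 h with h | h
  · exact Or.inl (toComplex_injective h)
  · exact Or.inr (toComplex_injective (h.trans (hneg _)))

lemma sum_refl_zroot [NeZero n] (a : ZMod n) (G : Plane → ℂ) (hG : ∀ v, G (-v) = G v) :
    ∑ b, G (refl n a (zroot n b)) = ∑ b, G (zroot n b) := by
  have : ∀ b, G (refl n a (zroot n b)) = G (zroot n (a - b + a)) := by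
    intro b
    rcases refl_zroot a b with h | h <;> rw [h]
    exact hG _
  simp only [this]
  exact Equiv.sum_comp ((Equiv.subLeft a).trans (Equiv.addRight a)) (fun b => G (zroot n b))

lemma dihedral_comp_refl [NeZero n] {g : Plane → Plane} (hg : g ∈ dihedral n) (a : ZMod n) :
    (fun x => g (refl n a x)) ∈ dihedral n := by
  have cast : ∀ j < n, j = ((j : ℕ) : ZMod n).val := fun j hj => (ZMod.val_natCast_of_lt hj).symm
  rcases hg with ⟨j, hj, rfl⟩ | ⟨j, hj, rfl⟩
  · refine Or.inr ⟨((j : ZMod n) + a).val, ZMod.val_lt _, ?_⟩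
    funext x
    conv_lhs => rw [cast j hj]
    rw [rotate_refl, ← reflect_zroot, zroot]
  · refine Or.inl ⟨((j : ZMod n) - a).val, ZMod.val_lt _, ?_⟩
    funext x
    conv_lhs => rw [cast j hj]
    simp only [← refl_refl, ← reflect_zroot, zroot]

lemma finite_dihedral (n : ℕ) : (dihedral n).Finite := by
  refine Set.Finite.union ?_ ?_
  · refine ((Set.finite_Iio n).image (fun j => rotate n j)).subset ?_
    rintro g ⟨j, hj, rfl⟩
    exact ⟨j, hj, rfl⟩
  · refine ((Set.finite_Iio n).image (fun j => reflect (root n j))).subset ?_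
    rintro g ⟨j, hj, rfl⟩
    exact ⟨j, hj, rfl⟩

lemma norm_pairing_le_orbitMax {g : Plane → Plane} (hg : g ∈ dihedral n) (x : Plane)
    (y : CPlane) : ‖pairing (g x) y‖ ≤ orbitMax n x y := by
  have : Finite (dihedral n) := finite_dihedral n
  exact le_ciSup (f := fun g : dihedral n => ‖pairing (g.1 x) y‖) (Set.finite_range _).bddAbove
    ⟨g, hg⟩

lemma id_mem_dihedral [NeZero n] : (fun x => x) ∈ dihedral n :=
  Or.inl ⟨0, Nat.pos_of_ne_zero (NeZero.ne n), by
    funext x; ext i; fin_cases i <;> simp [rotate]⟩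

lemma norm_pairing_le [NeZero n] (x : Plane) (y : CPlane) : ‖pairing x y‖ ≤ orbitMax n x y :=
  norm_pairing_le_orbitMax id_mem_dihedral x y

/-- Right composition with a reflection maps the group into itself. -/
lemma orbitMax_refl_le [NeZero n] (a : ZMod n) (x : Plane) (y : CPlane) :
    orbitMax n (refl n a x) y ≤ orbitMax n x y := by
  have : Nonempty (dihedral n) := ⟨⟨_, id_mem_dihedral⟩⟩
  exact ciSup_le fun g => norm_pairing_le_orbitMax (dihedral_comp_refl g.2 a) x y

lemma orbitMax_nonneg [NeZero n] (x : Plane) (y : CPlane) : 0 ≤ orbitMax n x y :=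
  (norm_nonneg _).trans (norm_pairing_le x y)

end Geometry

/-! ### Algebra of the Dunkl operators -/

section Operator

variable {n : ℕ} {k : ℂ}

lemma diffQuot_zroot (a : ZMod n) (f : Plane → ℂ) (x : Plane) :
    diffQuot (zroot n a) f x = if ⟪zroot n a, x⟫ = 0 then 2 * fderiv ℝ f x (zroot n a)
      else (f x - f (refl n a x)) / ((⟪zroot n a, x⟫ : ℝ) : ℂ) := by
  rw [diffQuot, reflect_zroot]
  simp

lemma refl_eq_self {a : ZMod n} {x : Plane} (h : ⟪zroot n a, x⟫ = 0) : refl n a x = x := by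
  rw [refl_apply, h]
  simp

lemma dunklOp_eq [NeZero n] (ξ : Plane) (f : Plane → ℂ) (x : Plane) :
    dunklOp n k ξ f x = fderiv ℝ f x ξ +
      k * ∑ a, ((⟪zroot n a, ξ⟫ : ℝ) : ℂ) * diffQuot (zroot n a) f x := by
  rw [dunklOp, sum_range_eq_sum_zmod
    (fun j => k * ((⟪root n j, ξ⟫ : ℝ) : ℂ) * diffQuot (root n j) f x), Finset.mul_sum]
  simp only [zroot, mul_assoc]

lemma diffQuot_add (α : Plane) {f g : Plane → ℂ} {x : Plane} (hf : DifferentiableAt ℝ f x)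
    (hg : DifferentiableAt ℝ g x) :
    diffQuot α (fun x => f x + g x) x = diffQuot α f x + diffQuot α g x := by
  unfold diffQuot
  split_ifs
  · rw [fderiv_fun_add hf hg, add_apply]
    ring
  · ring

lemma diffQuot_const_mul (α : Plane) (c : ℂ) {f : Plane → ℂ} {x : Plane}
    (hf : DifferentiableAt ℝ f x) :
    diffQuot α (fun x => c * f x) x = c * diffQuot α f x := by
  unfold diffQuot
  split_ifs
  · rw [fderiv_const_mul hf, smul_apply, smul_eq_mul]
    ring
  · ring

lemma diffQuot_neg (α : Plane) (f : Plane → ℂ) (x : Plane) :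
    diffQuot (-α) f x = -diffQuot α f x := by
  have h : reflect (-α) x = reflect α x := by
    simp [reflect, neg_div]
  unfold diffQuot
  simp only [h, inner_neg_left, neg_eq_zero, norm_neg]
  split_ifs
  · rw [map_neg, mul_neg]
  · rw [Complex.ofReal_neg, div_neg]

lemma fderiv_inner_mul (v : Plane) {f : Plane → ℂ} {x : Plane} (hf : DifferentiableAt ℝ f x)
    (ξ : Plane) : fderiv ℝ (fun x => ((⟪v, x⟫ : ℝ) : ℂ) * f x) x ξ =
      ((⟪v, x⟫ : ℝ) : ℂ) * fderiv ℝ f x ξ + ((⟪v, ξ⟫ : ℝ) : ℂ) * f x := by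
  have h : HasFDerivAt (fun x : Plane => ((⟪v, x⟫ : ℝ) : ℂ))
      (Complex.ofRealCLM.comp (innerSL ℝ v)) x :=
    (Complex.ofRealCLM.comp (innerSL ℝ v)).hasFDerivAt
  rw [(h.fun_mul hf.hasFDerivAt).fderiv]
  simp
  ring

lemma differentiable_inner_mul (v : Plane) {f : Plane → ℂ} (hf : Differentiable ℝ f) :
    Differentiable ℝ (fun x => ((⟪v, x⟫ : ℝ) : ℂ) * f x) :=
  (Complex.ofRealCLM.comp (innerSL ℝ v)).differentiable.mul hf

lemma diffQuot_inner_mul (a : ZMod n) (v : Plane) {f : Plane → ℂ} {x : Plane}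
    (hf : DifferentiableAt ℝ f x) :
    diffQuot (zroot n a) (fun x => ((⟪v, x⟫ : ℝ) : ℂ) * f x) x =
      ((⟪v, x⟫ : ℝ) : ℂ) * diffQuot (zroot n a) f x +
        2 * ((⟪zroot n a, v⟫ : ℝ) : ℂ) * f (refl n a x) := by
  rw [diffQuot_zroot, diffQuot_zroot]
  split_ifs with h
  · rw [fderiv_inner_mul v hf, refl_eq_self h, real_inner_comm v]
    ring
  · have h' : ((⟪zroot n a, x⟫ : ℝ) : ℂ) ≠ 0 := by exact_mod_cast h
    have e : ⟪v, refl n a x⟫ = ⟪v, x⟫ - 2 * ⟪zroot n a, x⟫ * ⟪zroot n a, v⟫ := by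
      rw [refl_apply, inner_sub_right, inner_smul_right, real_inner_comm v]
    rw [e]
    push_cast
    field_simp
    ring

lemma refl_reflect (a : ZMod n) (α x : Plane) :
    refl n a (reflect α x) = reflect (refl n a α) (refl n a x) := by
  rw [reflect, reflect, map_sub, map_smul, inner_refl_refl, norm_refl]

lemma fderiv_comp_refl (a : ZMod n) {f : Plane → ℂ} (hf : Differentiable ℝ f) (x ξ : Plane) :
    fderiv ℝ (fun x => f (refl n a x)) x ξ = fderiv ℝ f (refl n a x) (refl n a ξ) :=
  congrArg (fun L : Plane →L[ℝ] ℂ => L ξ)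
    ((hf _).hasFDerivAt.comp x (refl n a).hasFDerivAt).fderiv

lemma diffQuot_comp_refl (a : ZMod n) (α : Plane) {f : Plane → ℂ} (hf : Differentiable ℝ f)
    (x : Plane) : diffQuot α (fun x => f (refl n a x)) x =
      diffQuot (refl n a α) f (refl n a x) := by
  rw [diffQuot, diffQuot, fderiv_comp_refl a hf, refl_reflect, inner_refl_refl, norm_refl]

variable [NeZero n]

lemma dunklOp_add (ξ : Plane) {f g : Plane → ℂ} {x : Plane} (hf : DifferentiableAt ℝ f x)
    (hg : DifferentiableAt ℝ g x) :
    dunklOp n k ξ (fun x => f x + g x) x = dunklOp n k ξ f x + dunklOp n k ξ g x := by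
  simp only [dunklOp_eq, diffQuot_add _ hf hg, fderiv_fun_add hf hg, add_apply, mul_add,
    Finset.sum_add_distrib]
  ring

lemma dunklOp_const_mul (ξ : Plane) (c : ℂ) {f : Plane → ℂ} {x : Plane}
    (hf : DifferentiableAt ℝ f x) :
    dunklOp n k ξ (fun x => c * f x) x = c * dunklOp n k ξ f x := by
  simp only [dunklOp_eq, diffQuot_const_mul _ _ hf, fderiv_const_mul hf, smul_apply, smul_eq_mul,
    Finset.mul_sum, mul_add]
  congr 1
  exact Finset.sum_congr rfl fun a _ => by ring

lemma dunklOp_sub (ξ : Plane) {f g : Plane → ℂ} {x : Plane} (hf : DifferentiableAt ℝ f x)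
    (hg : DifferentiableAt ℝ g x) :
    dunklOp n k ξ (fun x => f x - g x) x = dunklOp n k ξ f x - dunklOp n k ξ g x := by
  have h := dunklOp_add (n := n) (k := k) ξ hf (hg.const_mul (-1 : ℂ))
  rw [dunklOp_const_mul ξ (-1) hg] at h
  simpa [sub_eq_add_neg] using h

lemma dunklOp_sum (ξ : Plane) {ι : Type*} (s : Finset ι) {f : ι → Plane → ℂ}
    (hf : ∀ i, Differentiable ℝ (f i)) (x : Plane) :
    dunklOp n k ξ (fun x => ∑ i ∈ s, f i x) x = ∑ i ∈ s, dunklOp n k ξ (f i) x := by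
  classical
  induction s using Finset.induction_on with
  | empty =>
    have := dunklOp_const_mul (n := n) (k := k) ξ 0 (f := fun _ => 0) (x := x)
      (differentiableAt_const _)
    simpa using this
  | insert i s hi ih =>
    simp only [Finset.sum_insert hi]
    rw [dunklOp_add ξ (hf i x) (Differentiable.fun_sum (fun i _ => hf i) x), ih]

lemma dunklOp_dir_add (ξ η : Plane) (f : Plane → ℂ) (x : Plane) :
    dunklOp n k (ξ + η) f x = dunklOp n k ξ f x + dunklOp n k η f x := by
  simp only [dunklOp_eq, map_add, inner_add_right, Complex.ofReal_add, add_mul,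
    Finset.sum_add_distrib]
  ring

lemma dunklOp_dir_smul (c : ℝ) (ξ : Plane) (f : Plane → ℂ) (x : Plane) :
    dunklOp n k (c • ξ) f x = c * dunklOp n k ξ f x := by
  simp only [dunklOp_eq, map_smul, inner_smul_right, Complex.ofReal_mul, mul_add, Finset.mul_sum,
    Complex.real_smul]
  congr 1
  exact Finset.sum_congr rfl fun a _ => by ring

lemma dunklOp_dir_refl (a : ZMod n) (ξ : Plane) (f : Plane → ℂ) (x : Plane) :
    dunklOp n k (refl n a ξ) f x = dunklOp n k ξ f x -
      2 * ((⟪zroot n a, ξ⟫ : ℝ) : ℂ) * dunklOp n k (zroot n a) f x := by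
  rw [refl_apply, sub_eq_add_neg, ← neg_smul, dunklOp_dir_add, dunklOp_dir_smul]
  push_cast
  ring

/-- The commutator of a Dunkl operator with multiplication by a linear form. -/
lemma dunklOp_inner_mul (ξ v : Plane) {f : Plane → ℂ} {x : Plane} (hf : DifferentiableAt ℝ f x) :
    dunklOp n k ξ (fun x => ((⟪v, x⟫ : ℝ) : ℂ) * f x) x =
      ((⟪v, x⟫ : ℝ) : ℂ) * dunklOp n k ξ f x + ((⟪v, ξ⟫ : ℝ) : ℂ) * f x +
        ∑ a, 2 * k * ((⟪zroot n a, ξ⟫ : ℝ) : ℂ) * ((⟪zroot n a, v⟫ : ℝ) : ℂ) *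
          f (refl n a x) := by
  simp only [dunklOp_eq, diffQuot_inner_mul _ _ hf, fderiv_inner_mul _ hf, mul_add,
    Finset.sum_add_distrib, Finset.mul_sum]
  have h₁ : ∀ a, k * (((⟪zroot n a, ξ⟫ : ℝ) : ℂ) * (((⟪v, x⟫ : ℝ) : ℂ) *
      diffQuot (zroot n a) f x)) = ((⟪v, x⟫ : ℝ) : ℂ) * (k * (((⟪zroot n a, ξ⟫ : ℝ) : ℂ) *
      diffQuot (zroot n a) f x)) := fun a => by ring
  have h₂ : ∀ a, k * (((⟪zroot n a, ξ⟫ : ℝ) : ℂ) * (2 * ((⟪zroot n a, v⟫ : ℝ) : ℂ) *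
      f (refl n a x))) = 2 * k * ((⟪zroot n a, ξ⟫ : ℝ) : ℂ) * ((⟪zroot n a, v⟫ : ℝ) : ℂ) *
      f (refl n a x) := fun a => by ring
  simp only [h₁, h₂]
  ring

/-- Equivariance of the Dunkl operators. -/
lemma dunklOp_comp_refl (a : ZMod n) (ξ : Plane) {f : Plane → ℂ} (hf : Differentiable ℝ f)
    (x : Plane) : dunklOp n k ξ (fun x => f (refl n a x)) x =
      dunklOp n k (refl n a ξ) f (refl n a x) := by
  rw [dunklOp_eq, dunklOp_eq, fderiv_comp_refl a hf]
  congr 2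
  rw [← sum_refl_zroot a
    (fun α => ((⟪α, refl n a ξ⟫ : ℝ) : ℂ) * diffQuot α f (refl n a x))]
  · refine Finset.sum_congr rfl fun b _ => ?_
    rw [diffQuot_comp_refl a _ hf, inner_refl_refl]
  · intro v
    rw [diffQuot_neg, inner_neg_left]
    push_cast
    ring

/-- The factor `⟨α, ξ⟩` at `ξ = x` cancels the denominator; on the line `⟨α, x⟩ = 0` both sides of
the cancellation vanish, since `σ_α x = x`. -/
lemma dunklOp_self (f : Plane → ℂ) (x : Plane) :
    dunklOp n k x f x = fderiv ℝ f x x + k * ∑ a, (f x - f (refl n a x)) := by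
  rw [dunklOp_eq]
  congr 2
  refine Finset.sum_congr rfl fun a _ => ?_
  rw [diffQuot_zroot]
  split_ifs with h
  · rw [h, refl_eq_self h]
    simp
  · have h' : ((⟪zroot n a, x⟫ : ℝ) : ℂ) ≠ 0 := by exact_mod_cast h
    field_simp

end Operator

/-! ### Homogeneous polynomials and commutativity -/

section Homogeneous

/-- The homogeneous polynomial functions of degree `m` on the plane. -/
def homog : ℕ → Submodule ℂ (Plane → ℂ)
  | 0 => Submodule.span ℂ {fun _ => 1}
  | m + 1 => Submodule.span ℂ
      {g | ∃ v : Plane, ∃ f ∈ homog m, g = fun x => ((⟪v, x⟫ : ℝ) : ℂ) * f x}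

lemma mem_homog_zero {f : Plane → ℂ} : f ∈ homog 0 ↔ ∃ c : ℂ, f = fun _ => c := by
  rw [homog, Submodule.mem_span_singleton]
  constructor
  · rintro ⟨c, rfl⟩
    exact ⟨c, by ext; simp⟩
  · rintro ⟨c, rfl⟩
    exact ⟨c, by ext; simp⟩

lemma inner_mul_mem_homog {m : ℕ} (v : Plane) {f : Plane → ℂ} (hf : f ∈ homog m) :
    (fun x => ((⟪v, x⟫ : ℝ) : ℂ) * f x) ∈ homog (m + 1) :=
  Submodule.subset_span ⟨v, f, hf, rfl⟩

lemma homog_succ_induction {m : ℕ} {p : (Plane → ℂ) → Prop}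
    (mul : ∀ v, ∀ f ∈ homog m, p fun x => ((⟪v, x⟫ : ℝ) : ℂ) * f x) (zero : p fun _ => 0)
    (add : ∀ f ∈ homog (m + 1), ∀ g ∈ homog (m + 1), p f → p g → p fun x => f x + g x)
    (smul : ∀ c : ℂ, ∀ f ∈ homog (m + 1), p f → p fun x => c * f x) {f : Plane → ℂ}
    (hf : f ∈ homog (m + 1)) : p f := by
  refine Submodule.span_induction (p := fun f _ => p f) ?_ zero ?_ ?_ hf
  · rintro _ ⟨v, f, hf, rfl⟩
    exact mul v f hf
  · exact fun f g hf hg => add f hf g hg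
  · exact fun c f hf => smul c f hf

lemma differentiable_of_mem_homog {m : ℕ} {f : Plane → ℂ} (hf : f ∈ homog m) :
    Differentiable ℝ f := by
  induction m generalizing f with
  | zero =>
    obtain ⟨c, rfl⟩ := mem_homog_zero.1 hf
    exact differentiable_const c
  | succ m ih =>
    exact homog_succ_induction (fun v f hf => differentiable_inner_mul v (ih hf))
      (differentiable_const 0) (fun f _ g _ hf hg => hf.add hg)
      (fun c f _ hf => hf.const_mul c) hf

lemma fderiv_self_of_mem_homog {m : ℕ} {f : Plane → ℂ} (hf : f ∈ homog m) (x : Plane) :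
    fderiv ℝ f x x = m * f x := by
  induction m generalizing f with
  | zero =>
    obtain ⟨c, rfl⟩ := mem_homog_zero.1 hf
    simp
  | succ m ih =>
    refine homog_succ_induction (p := fun f => fderiv ℝ f x x = ((m + 1 : ℕ) : ℂ) * f x)
      (fun v f hf => ?_) ?_ (fun f hf' g hg' hf hg => ?_) (fun c f hf' hf => ?_) hf
    · rw [fderiv_inner_mul v (differentiable_of_mem_homog hf x), ih hf]
      push_cast
      ring
    · simp
    · rw [fderiv_fun_add (differentiable_of_mem_homog hf' x) (differentiable_of_mem_homog hg' x),
        add_apply, hf, hg]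
      ring
    · rw [fderiv_const_mul (differentiable_of_mem_homog hf' x), smul_apply, hf, smul_eq_mul]
      ring

variable {n : ℕ} {k : ℂ} [NeZero n]

lemma inner_refl_left (a : ZMod n) (x y : Plane) : ⟪refl n a x, y⟫ = ⟪x, refl n a y⟫ := by
  rw [← inner_refl_refl a, refl_self]

lemma comp_refl_mem_homog (a : ZMod n) {m : ℕ} {f : Plane → ℂ} (hf : f ∈ homog m) :
    (fun x => f (refl n a x)) ∈ homog m := by
  induction m generalizing f with
  | zero =>
    obtain ⟨c, rfl⟩ := mem_homog_zero.1 hf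
    exact hf
  | succ m ih =>
    refine homog_succ_induction (p := fun f => (fun x => f (refl n a x)) ∈ homog (m + 1))
      (fun v f hf => ?_) ?_ (fun f _ g _ hf hg => ?_) (fun c f _ hf => ?_) hf
    · simp only [← inner_refl_left]
      exact inner_mul_mem_homog _ (ih hf)
    · exact Submodule.zero_mem _
    · exact Submodule.add_mem _ hf hg
    · exact Submodule.smul_mem _ c hf

lemma sum_mem_homog {m : ℕ} {ι : Type*} (s : Finset ι) {f : ι → Plane → ℂ}
    (hf : ∀ i, f i ∈ homog m) : (fun x => ∑ i ∈ s, f i x) ∈ homog m := by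
  have h : (fun x => ∑ i ∈ s, f i x) = ∑ i ∈ s, f i := by
    ext x
    simp
  rw [h]
  exact Submodule.sum_mem _ fun i _ => hf i

omit [NeZero n] in
lemma dunklOp_const (ξ : Plane) (c : ℂ) : dunklOp n k ξ (fun _ => c) = fun _ => 0 := by
  funext x
  simp [dunklOp, diffQuot]

lemma dunklOp_fun_add (ξ : Plane) {f g : Plane → ℂ} (hf : Differentiable ℝ f)
    (hg : Differentiable ℝ g) : dunklOp n k ξ (fun x => f x + g x) =
      fun x => dunklOp n k ξ f x + dunklOp n k ξ g x :=
  funext fun x => dunklOp_add ξ (hf x) (hg x)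

lemma dunklOp_fun_const_mul (ξ : Plane) (c : ℂ) {f : Plane → ℂ} (hf : Differentiable ℝ f) :
    dunklOp n k ξ (fun x => c * f x) = fun x => c * dunklOp n k ξ f x :=
  funext fun x => dunklOp_const_mul ξ c (hf x)

lemma dunklOp_fun_inner_mul (ξ v : Plane) {f : Plane → ℂ} (hf : Differentiable ℝ f) :
    dunklOp n k ξ (fun x => ((⟪v, x⟫ : ℝ) : ℂ) * f x) = fun x =>
      ((⟪v, x⟫ : ℝ) : ℂ) * dunklOp n k ξ f x + ((⟪v, ξ⟫ : ℝ) : ℂ) * f x +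
        ∑ a, 2 * k * ((⟪zroot n a, ξ⟫ : ℝ) : ℂ) * ((⟪zroot n a, v⟫ : ℝ) : ℂ) *
          f (refl n a x) :=
  funext fun x => dunklOp_inner_mul ξ v (hf x)

lemma dunklOp_mem_homog (ξ : Plane) {m : ℕ} {f : Plane → ℂ} (hf : f ∈ homog (m + 1)) :
    dunklOp n k ξ f ∈ homog m := by
  -- The term `⟨v, x⟩ T_ξ f` of the commutator formula is the only one needing the induction
  -- hypothesis. It is isolated because for `m = 0` there is no degree `m - 1`, and `T_ξ f = 0` is
  -- used instead.
  have key : ∀ m, (∀ v : Plane, ∀ f ∈ homog m,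
      (fun x => ((⟪v, x⟫ : ℝ) : ℂ) * dunklOp n k ξ f x) ∈ homog m) →
      ∀ f ∈ homog (m + 1), dunklOp n k ξ f ∈ homog m := by
    intro m h f hf
    refine homog_succ_induction (p := fun f => dunklOp n k ξ f ∈ homog m)
      (fun v f hf => ?_) ?_ (fun f hf' g hg' hf hg => ?_) (fun c f hf' hf => ?_) hf
    · rw [dunklOp_fun_inner_mul ξ v (differentiable_of_mem_homog hf)]
      refine Submodule.add_mem _ (Submodule.add_mem _ (h v f hf) (Submodule.smul_mem _ _ hf)) ?_
      exact sum_mem_homog _ fun a => Submodule.smul_mem _ _ (comp_refl_mem_homog a hf)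
    · rw [dunklOp_const]
      exact Submodule.zero_mem _
    · rw [dunklOp_fun_add ξ (differentiable_of_mem_homog hf') (differentiable_of_mem_homog hg')]
      exact Submodule.add_mem _ hf hg
    · rw [dunklOp_fun_const_mul ξ c (differentiable_of_mem_homog hf')]
      exact Submodule.smul_mem _ c hf
  induction m generalizing f with
  | zero =>
    refine key 0 (fun v f hf => ?_) f hf
    obtain ⟨c, rfl⟩ := mem_homog_zero.1 hf
    simp only [dunklOp_const, mul_zero]
    exact Submodule.zero_mem _
  | succ m ih => exact key (m + 1) (fun v f hf => inner_mul_mem_homog v (ih hf)) f hf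

lemma differentiable_dunklOp (ξ : Plane) {m : ℕ} {f : Plane → ℂ} (hf : f ∈ homog m) :
    Differentiable ℝ (dunklOp n k ξ f) := by
  cases m with
  | zero =>
    obtain ⟨c, rfl⟩ := mem_homog_zero.1 hf
    rw [dunklOp_const]
    exact differentiable_const 0
  | succ m => exact differentiable_of_mem_homog (dunklOp_mem_homog ξ hf)

/-- Equivariance and `T_{σξ} = T_ξ - 2⟨α, ξ⟩ T_α` bring the reflected terms into this form. Apart
from `T_ξ T_η f`, the right side is symmetric in `ξ` and `η`, so commutativity passes from `f` to
`⟨v, ·⟩ f`. -/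
lemma dunklOp_dunklOp_inner_mul (ξ η v : Plane) {m : ℕ} {f : Plane → ℂ} (hf : f ∈ homog m)
    (x : Plane) : dunklOp n k ξ (dunklOp n k η fun x => ((⟪v, x⟫ : ℝ) : ℂ) * f x) x =
      ((⟪v, x⟫ : ℝ) : ℂ) * dunklOp n k ξ (dunklOp n k η f) x +
        ((⟪v, ξ⟫ : ℝ) : ℂ) * dunklOp n k η f x + ((⟪v, η⟫ : ℝ) : ℂ) * dunklOp n k ξ f x +
        ∑ a, 2 * k * ((⟪zroot n a, v⟫ : ℝ) : ℂ) *
          (((⟪zroot n a, ξ⟫ : ℝ) : ℂ) * dunklOp n k η f (refl n a x) +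
          ((⟪zroot n a, η⟫ : ℝ) : ℂ) * dunklOp n k ξ f (refl n a x) -
          2 * ((⟪zroot n a, ξ⟫ : ℝ) : ℂ) * ((⟪zroot n a, η⟫ : ℝ) : ℂ) *
            dunklOp n k (zroot n a) f (refl n a x)) := by
  have hd := differentiable_of_mem_homog hf
  have hT := differentiable_dunklOp (n := n) (k := k) η hf
  have hr : ∀ a, Differentiable ℝ (fun x => f (refl n a x)) := fun a =>
    differentiable_of_mem_homog (comp_refl_mem_homog a hf)
  rw [dunklOp_fun_inner_mul η v hd]
  have h1 := differentiable_inner_mul v hT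
  have h2 := hd.const_mul ((⟪v, η⟫ : ℝ) : ℂ)
  rw [dunklOp_add ξ ((h1 x).fun_add (h2 x))
      (Differentiable.fun_sum (fun a _ => (hr a).const_mul _) x),
    dunklOp_add ξ (h1 x) (h2 x), dunklOp_inner_mul ξ v (hT x), dunklOp_const_mul ξ _ (hd x),
    dunklOp_sum ξ _ (fun a => (hr a).const_mul _)]
  have h3 : ∀ a, dunklOp n k ξ (fun x => 2 * k * ((⟪zroot n a, η⟫ : ℝ) : ℂ) *
      ((⟪zroot n a, v⟫ : ℝ) : ℂ) * f (refl n a x)) x = 2 * k * ((⟪zroot n a, η⟫ : ℝ) : ℂ) *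
      ((⟪zroot n a, v⟫ : ℝ) : ℂ) * (dunklOp n k ξ f (refl n a x) -
      2 * ((⟪zroot n a, ξ⟫ : ℝ) : ℂ) * dunklOp n k (zroot n a) f (refl n a x)) := by
    intro a
    rw [dunklOp_const_mul ξ _ (hr a x), dunklOp_comp_refl a ξ hd, dunklOp_dir_refl]
  simp only [h3]
  rw [add_right_comm _ (Finset.sum _ _), add_assoc _ (Finset.sum _ _),
    ← Finset.sum_add_distrib]
  congr 1
  exact Finset.sum_congr rfl fun a _ => by ring

/-- The Dunkl operators commute on polynomials. -/
lemma dunklOp_comm (ξ η : Plane) {m : ℕ} {f : Plane → ℂ} (hf : f ∈ homog m) (x : Plane) :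
    dunklOp n k ξ (dunklOp n k η f) x = dunklOp n k η (dunklOp n k ξ f) x := by
  induction m generalizing f x with
  | zero =>
    obtain ⟨c, rfl⟩ := mem_homog_zero.1 hf
    simp only [dunklOp_const]
  | succ m ih =>
    refine homog_succ_induction (p := fun f => ∀ x,
      dunklOp n k ξ (dunklOp n k η f) x = dunklOp n k η (dunklOp n k ξ f) x)
      (fun v f hf x => ?_) (fun x => ?_) (fun f hf' g hg' hf hg x => ?_)
      (fun c f hf' hf x => ?_) hf x
    · rw [dunklOp_dunklOp_inner_mul ξ η v hf, dunklOp_dunklOp_inner_mul η ξ v hf, ih hf]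
      congr 1
      · ring
      · exact Finset.sum_congr rfl fun a _ => by ring
    · simp only [dunklOp_const]
    · have hf₁ := differentiable_of_mem_homog hf'
      have hg₁ := differentiable_of_mem_homog hg'
      rw [dunklOp_fun_add ξ hf₁ hg₁, dunklOp_fun_add η hf₁ hg₁,
        dunklOp_add _ (differentiable_dunklOp _ hf' x) (differentiable_dunklOp _ hg' x),
        dunklOp_add _ (differentiable_dunklOp _ hf' x) (differentiable_dunklOp _ hg' x), hf, hg]
    · have hf₁ := differentiable_of_mem_homog hf'
      rw [dunklOp_fun_const_mul ξ c hf₁, dunklOp_fun_const_mul η c hf₁,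
        dunklOp_const_mul _ _ (differentiable_dunklOp _ hf' x),
        dunklOp_const_mul _ _ (differentiable_dunklOp _ hf' x), hf]

end Homogeneous

/-! ### Homogeneous components of the kernel -/

section Terms

/-- The standard basis vectors of the plane. -/
def stdVec (i : Fin 2) : Plane := EuclideanSpace.single i 1

lemma inner_stdVec (i : Fin 2) (x : Plane) : ⟪stdVec i, x⟫ = x i := by
  simp [stdVec, EuclideanSpace.inner_single_left]

lemma sum_inner_stdVec_mul {L : Plane → ℂ} (hadd : ∀ u v, L (u + v) = L u + L v)
    (hsmul : ∀ (c : ℝ) u, L (c • u) = c * L u) (u : Plane) :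
    ∑ i, ((⟪stdVec i, u⟫ : ℝ) : ℂ) * L (stdVec i) = L u := by
  have h : u = u 0 • stdVec 0 + u 1 • stdVec 1 := by
    ext i
    fin_cases i <;> simp [stdVec]
  conv_rhs => rw [h]
  rw [hadd, hsmul, hsmul, Fin.sum_univ_two, inner_stdVec, inner_stdVec]

lemma pairing_eq (x : Plane) (y : CPlane) : pairing x y =
    y 0 * ((⟪stdVec 0, x⟫ : ℝ) : ℂ) + y 1 * ((⟪stdVec 1, x⟫ : ℝ) : ℂ) := by
  rw [inner_stdVec, inner_stdVec, pairing]
  ring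

lemma pairing_add (u v : Plane) (y : CPlane) :
    pairing (u + v) y = pairing u y + pairing v y := by
  simp [pairing]
  ring

lemma pairing_smul (c : ℝ) (u : Plane) (y : CPlane) :
    pairing (c • u) y = c * pairing u y := by
  simp [pairing]
  ring

lemma pairing_mul_mem_homog {m : ℕ} (y : CPlane) {f : Plane → ℂ} (hf : f ∈ homog m) :
    (fun x => pairing x y * f x) ∈ homog (m + 1) := by
  have h : (fun x => pairing x y * f x) =
      y 0 • (fun x => ((⟪stdVec 0, x⟫ : ℝ) : ℂ) * f x) +
        y 1 • (fun x => ((⟪stdVec 1, x⟫ : ℝ) : ℂ) * f x) := by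
    funext x
    simp only [pairing_eq, Pi.add_apply, Pi.smul_apply, smul_eq_mul]
    ring
  rw [h]
  exact Submodule.add_mem _ (Submodule.smul_mem _ _ (inner_mul_mem_homog _ hf))
    (Submodule.smul_mem _ _ (inner_mul_mem_homog _ hf))

variable {n : ℕ} {k : ℂ}

/-- The value `-m` is the excluded half-integer `-(2m)/2`. -/
lemma natCast_add_ne_zero (hk : ∀ m : ℕ, 1 ≤ m → (n : ℂ) * k ≠ -(m : ℂ) / 2) {m : ℕ}
    (hm : 1 ≤ m) : (m : ℂ) + n * k ≠ 0 := fun h =>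
  hk (2 * m) (by omega) (by push_cast; linear_combination h)

lemma natCast_add_sq_ne (hk : ∀ m : ℕ, 1 ≤ m → (n : ℂ) * k ≠ -(m : ℂ) / 2) {m : ℕ}
    (hm : 1 ≤ m) : ((m : ℂ) + n * k) ^ 2 ≠ (n * k) ^ 2 := by
  intro h
  have hm' : (m : ℂ) ≠ 0 := by exact_mod_cast (by omega : m ≠ 0)
  have h' : (m : ℂ) * (m + 2 * (n * k)) = 0 := by linear_combination h
  refine hk m hm ?_
  linear_combination (mul_eq_zero.1 h').resolve_left hm' / 2

variable [NeZero n]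

/-- The eigenvalue equation for `T_x` at `x` implies the equation for all `T_ξ`. -/
lemma dunklOp_eq_of_self (hk : ∀ m : ℕ, 1 ≤ m → (n : ℂ) * k ≠ -(m : ℂ) / 2) (y : CPlane) {m : ℕ}
    {f g : Plane → ℂ} (hf : f ∈ homog (m + 1)) (hg : g ∈ homog m)
    (hsymm : ∀ ξ η x, pairing ξ y * dunklOp n k η g x = pairing η y * dunklOp n k ξ g x)
    (hself : ∀ x, dunklOp n k x f x = pairing x y * g x) (ξ x : Plane) :
    dunklOp n k ξ f x = pairing ξ y * g x := by
  -- The defect, linear in `ξ` and homogeneous of degree `m` in `x`. Commutativity and `hsymm` make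
  -- it closed, `T_ξ p_η = T_η p_ξ`, and `hself` gives `p_x(x) = 0`.
  set p : Plane → Plane → ℂ := fun ξ x => dunklOp n k ξ f x - pairing ξ y * g x with hp
  have pmem : ∀ ξ, p ξ ∈ homog m := fun ξ =>
    Submodule.sub_mem _ (dunklOp_mem_homog ξ hf) (Submodule.smul_mem _ _ hg)
  have pdiff : ∀ ξ, Differentiable ℝ (p ξ) := fun ξ => differentiable_of_mem_homog (pmem ξ)
  have gdiff := differentiable_of_mem_homog hg
  have padd : ∀ x u v, p (u + v) x = p u x + p v x := fun x u v => by
    simp only [hp, dunklOp_dir_add, pairing_add]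
    ring
  have psmul : ∀ x (c : ℝ) u, p (c • u) x = c * p u x := fun x c u => by
    simp only [hp, dunklOp_dir_smul, pairing_smul]
    ring
  have psum : ∀ u x, ∑ i, ((⟪stdVec i, u⟫ : ℝ) : ℂ) * p (stdVec i) x = p u x := fun u x =>
    sum_inner_stdVec_mul (L := fun u => p u x) (padd x) (psmul x) u
  have pcomm : ∀ ξ η x, dunklOp n k ξ (p η) x = dunklOp n k η (p ξ) x := by
    intro ξ η x
    have e : ∀ ξ η, dunklOp n k ξ (p η) x =
        dunklOp n k ξ (dunklOp n k η f) x - pairing η y * dunklOp n k ξ g x := fun ξ η => by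
      rw [hp, dunklOp_sub ξ (differentiable_dunklOp η hf x) ((gdiff x).const_mul _),
        dunklOp_const_mul ξ _ (gdiff x)]
    rw [e, e, dunklOp_comm ξ η hf, hsymm ξ η]
  have pself : ∀ x, p x x = 0 := fun x => by rw [hp]; exact sub_eq_zero.2 (hself x)
  clear_value p
  -- Apply `T_η` to `∑ x_i p_i = 0`. Closedness turns `∑ x_i T_η p_i` into `T_x p_η = m p_η + k ∑
  -- (p_η - p_η ∘ σ_α)`; the commutator contributes `p_η + k ∑ (p_η - p_{σ_α η}) ∘ σ_α`, and the
  -- terms `p_η ∘ σ_α` cancel.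
  have hrel : ∀ q : Plane × Plane, (((m + 1 : ℕ) : ℂ) + n * k) * p q.1 q.2 =
      k * ∑ a, p (refl n a q.1) (refl n a q.2) := by
    rintro ⟨η, x⟩
    have h0 : dunklOp n k η (fun x => ∑ i, ((⟪stdVec i, x⟫ : ℝ) : ℂ) * p (stdVec i) x) x = 0 := by
      have : (fun x => ∑ i, ((⟪stdVec i, x⟫ : ℝ) : ℂ) * p (stdVec i) x) = fun _ => 0 := by
        funext x
        rw [psum, pself]
      rw [this, dunklOp_const]
    rw [dunklOp_sum η _ fun i => differentiable_inner_mul _ (pdiff _)] at h0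
    have hmul : ∀ i, dunklOp n k η (fun x => ((⟪stdVec i, x⟫ : ℝ) : ℂ) * p (stdVec i) x) x = _ :=
      fun i => dunklOp_inner_mul η (stdVec i) (pdiff (stdVec i) x)
    simp only [hmul, pcomm η] at h0
    rw [Finset.sum_add_distrib, Finset.sum_add_distrib,
      sum_inner_stdVec_mul (L := fun v => dunklOp n k v (p η) x)
        (fun u v => dunklOp_dir_add u v _ x) (fun c u => dunklOp_dir_smul c u _ x),
      psum, Finset.sum_comm, dunklOp_self,
      fderiv_self_of_mem_homog (pmem η)] at h0
    have h1 : ∀ a, ∑ i, 2 * k * ((⟪zroot n a, η⟫ : ℝ) : ℂ) * ((⟪zroot n a, stdVec i⟫ : ℝ) : ℂ) *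
        p (stdVec i) (refl n a x) =
        k * (p η (refl n a x) - p (refl n a η) (refl n a x)) := by
      intro a
      have h2 := psum (zroot n a) (refl n a x)
      have h3 : p (refl n a η) (refl n a x) = p η (refl n a x) -
          2 * ((⟪zroot n a, η⟫ : ℝ) : ℂ) * p (zroot n a) (refl n a x) := by
        rw [refl_apply a η, sub_eq_add_neg, ← neg_smul, padd, psmul]
        push_cast
        ring
      rw [h3, ← h2, Finset.mul_sum]
      simp only [sub_sub_cancel, real_inner_comm (zroot n a)]
      rw [Finset.mul_sum]
      exact Finset.sum_congr rfl fun i _ => by ring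
    simp only [h1] at h0
    rw [← Finset.mul_sum, Finset.sum_sub_distrib, Finset.sum_sub_distrib, Finset.sum_const,
      Finset.card_univ, ZMod.card, nsmul_eq_mul] at h0
    push_cast
    linear_combination h0
  have hr : ∀ (a b c : ZMod n) (q : Plane × Plane),
      Prod.map (refl n a) (refl n a) (Prod.map (refl n b) (refl n b)
        (Prod.map (refl n c) (refl n c) q)) =
      Prod.map (refl n (a - b + c)) (refl n (a - b + c)) q := fun a b c q => by
    simp [Prod.map, refl_refl_refl]
  refine sub_eq_zero.1 (Eq.trans (by rw [hp]) (eq_zero_of_mul_eq_sum (r := fun a => Prod.map (refl n a) (refl n a)) hr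
    (natCast_add_ne_zero hk m.succ_pos) (natCast_add_sq_ne hk m.succ_pos)
    (f := fun q => p q.1 q.2) hrel (ξ, x)))

variable (n k) in
/-- The homogeneous components of the Dunkl kernel. -/
def dunklTerm (y : CPlane) : ℕ → Plane → ℂ
  | 0 => fun _ => 1
  | m + 1 => resolvent (fun a => refl n a) k (((m + 1 : ℕ) : ℂ) + n * k)
      fun x => pairing x y * dunklTerm y m x

lemma resolvent_mem_homog (μ : ℂ) {m : ℕ} {f : Plane → ℂ} (hf : f ∈ homog m) :
    resolvent (fun a => refl n a) k μ f ∈ homog m := by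
  refine Submodule.add_mem _ (Submodule.add_mem _ (Submodule.smul_mem _ _ hf)
    (Submodule.smul_mem _ _ ?_)) (Submodule.smul_mem _ _ ?_)
  · exact sum_mem_homog _ fun a => comp_refl_mem_homog a hf
  · exact sum_mem_homog _ fun a => sum_mem_homog _ fun b =>
      comp_refl_mem_homog a (comp_refl_mem_homog b hf)

lemma dunklTerm_mem_homog (y : CPlane) (m : ℕ) : dunklTerm n k y m ∈ homog m := by
  induction m with
  | zero => exact mem_homog_zero.2 ⟨1, rfl⟩
  | succ m ih => exact resolvent_mem_homog _ (pairing_mul_mem_homog y ih)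

lemma dunklOp_dunklTerm_zero (y : CPlane) (ξ x : Plane) :
    dunklOp n k ξ (dunklTerm n k y 0) x = 0 := by
  rw [dunklTerm, dunklOp_const]

/-- The resolvent solves the radial equation; the symmetry needed to extend it to all `ξ` is the
present statement one degree lower, as both sides become `⟨ξ, y⟩⟨η, y⟩ E_{m-1}`. -/
lemma dunklOp_dunklTerm_succ (hk : ∀ m : ℕ, 1 ≤ m → (n : ℂ) * k ≠ -(m : ℂ) / 2) (y : CPlane)
    (m : ℕ) (ξ x : Plane) :
    dunklOp n k ξ (dunklTerm n k y (m + 1)) x = pairing ξ y * dunklTerm n k y m x := by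
  have hself : ∀ m x, dunklOp n k x (dunklTerm n k y (m + 1)) x =
      pairing x y * dunklTerm n k y m x := by
    intro m x
    have h := resolvent_spec (r := fun a => refl n a) refl_refl_refl
      (natCast_add_ne_zero hk m.succ_pos) (natCast_add_sq_ne hk m.succ_pos)
      (fun x => pairing x y * dunklTerm n k y m x) x
    rw [dunklOp_self, fderiv_self_of_mem_homog (dunklTerm_mem_homog y (m + 1)),
      Finset.sum_sub_distrib, Finset.sum_const, Finset.card_univ, ZMod.card, nsmul_eq_mul, ← h,
      dunklTerm]
    ring
  induction m generalizing ξ x with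
  | zero =>
    refine dunklOp_eq_of_self hk y (dunklTerm_mem_homog y 1) (dunklTerm_mem_homog y 0)
      (fun ξ η x => ?_) (hself 0) ξ x
    simp only [dunklOp_dunklTerm_zero, mul_zero]
  | succ m ih =>
    refine dunklOp_eq_of_self hk y (dunklTerm_mem_homog y _) (dunklTerm_mem_homog y _)
      (fun ξ η x => ?_) (hself _) ξ x
    rw [ih, ih]
    ring

end Terms

/-! ### Convergence, analyticity and the exponential bound -/

section Series

variable {n : ℕ} {k : ℂ} [NeZero n] {δ : ℝ}

/-- Each degree costs a factor `a` from the pairing and `δ / (m + 1)` from the resolvent. Since `a`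
does not increase under reflections, one bound serves every sampled point. -/
lemma norm_dunklTerm_le (hδ : ∀ m : ℕ, 1 ≤ m → resolventBound n k (m + n * k) ≤ δ / m)
    (y : CPlane) (m : ℕ) (x : Plane) :
    ‖dunklTerm n k y m x‖ ≤ (δ * orbitMax n x y) ^ m / m.factorial := by
  induction m generalizing x with
  | zero => simp [dunklTerm]
  | succ m ih =>
    have hδ0 : 0 ≤ δ := by
      refine le_trans ?_ ((hδ 1 le_rfl).trans_eq (by simp))
      unfold resolventBound
      positivity
    have h0 : ∀ z, orbitMax n z y ≤ orbitMax n x y → ‖pairing z y * dunklTerm n k y m z‖ ≤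
        orbitMax n x y * ((δ * orbitMax n x y) ^ m / m.factorial) := by
      intro z hz
      have := orbitMax_nonneg (n := n) z y
      rw [norm_mul]
      refine mul_le_mul ((norm_pairing_le z y).trans hz) ((ih z).trans ?_) (norm_nonneg _)
        (this.trans hz)
      gcongr
    have hB : 0 ≤ orbitMax n x y * ((δ * orbitMax n x y) ^ m / m.factorial) :=
      (norm_nonneg _).trans (h0 x le_rfl)
    refine (norm_resolvent_le (r := fun a => refl n a) (h0 x le_rfl)
      (fun a => h0 _ (orbitMax_refl_le a x y))
      (fun a b => h0 _ ((orbitMax_refl_le b _ y).trans (orbitMax_refl_le a x y)))).trans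
      ((mul_le_mul_of_nonneg_right (hδ (m + 1) m.succ_pos) hB).trans_eq ?_)
    rw [Nat.factorial_succ, pow_succ]
    push_cast
    field_simp

/-- The bilinear pairing as a continuous linear map in the first variable. -/
def pairingL (y : CPlane) : Plane →L[ℝ] ℂ :=
  y 0 • Complex.ofRealCLM.comp (innerSL ℝ (stdVec 0)) +
    y 1 • Complex.ofRealCLM.comp (innerSL ℝ (stdVec 1))

lemma pairingL_apply (x : Plane) (y : CPlane) : pairingL y x = pairing x y := by
  rw [pairing_eq]
  simp [pairingL]

/-- Lets the recursion run on multilinear forms, which supply the power series behind analyticity.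
Reflections are isometries, so the operator norm obeys the same resolvent bound. -/
lemma exists_multilinear_resolvent (μ : ℂ) {m : ℕ} (φ : Plane [×m]→L[ℝ] ℂ) :
    ∃ ψ : Plane [×m]→L[ℝ] ℂ, ‖ψ‖ ≤ resolventBound n k μ * ‖φ‖ ∧
      ∀ x, ψ (fun _ => x) = resolvent (fun a => refl n a) k μ (fun x => φ fun _ => x) x := by
  let c : ZMod n → Plane [×m]→L[ℝ] ℂ := fun a =>
    φ.compContinuousLinearMap fun _ => refl n a
  let d : ZMod n → ZMod n → Plane [×m]→L[ℝ] ℂ := fun a b =>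
    φ.compContinuousLinearMap fun _ => (refl n b).comp (refl n a)
  refine ⟨μ⁻¹ • φ + (k / (μ ^ 2 - (n * k) ^ 2)) • ∑ a, c a +
    (k ^ 2 / (μ * (μ ^ 2 - (n * k) ^ 2))) • ∑ a, ∑ b, d a b, ?_, fun x => ?_⟩
  · have hB : 0 ≤ resolventBound n k μ := by
      unfold resolventBound
      positivity
    refine ContinuousMultilinearMap.opNorm_le_bound (by positivity) fun v => ?_
    -- Here the reflections act diagonally on tuples, with `B = ‖φ‖ ∏ ‖v i‖`.
    have h := norm_resolvent_le (r := fun (a : ZMod n) (v : Fin m → Plane) i => refl n a (v i))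
      (k := k) (μ := μ) (f := φ) (x := v) (φ.le_opNorm v)
      (fun a => (φ.le_opNorm _).trans_eq (by simp only [norm_refl]))
      (fun a b => (φ.le_opNorm _).trans_eq (by simp only [norm_refl]))
    rw [mul_assoc]
    refine le_trans (le_of_eq ?_) h
    simp [resolvent, c, d]
  · simp [resolvent, c, d]

lemma exists_multilinear_dunklTerm
    (hδ : ∀ m : ℕ, 1 ≤ m → resolventBound n k (m + n * k) ≤ δ / m) (y : CPlane) (m : ℕ) :
    ∃ φ : Plane [×m]→L[ℝ] ℂ, ‖φ‖ ≤ (δ * ‖pairingL y‖) ^ m / m.factorial ∧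
      ∀ x, dunklTerm n k y m x = φ fun _ => x := by
  induction m with
  | zero =>
    refine ⟨ContinuousMultilinearMap.uncurry0 ℝ Plane 1, ?_, fun x => ?_⟩
    · simp
    · simp [dunklTerm]
  | succ m ih =>
    obtain ⟨φ, hφ, hφ'⟩ := ih
    let L : Plane [×(m + 1)]→L[ℝ] ℂ :=
      ContinuousLinearMap.uncurryLeft (Ei := fun _ : Fin (m + 1) => Plane)
        ((pairingL y).smulRight φ)
    obtain ⟨ψ, hψ, hψ'⟩ := exists_multilinear_resolvent (n := n) (k := k)
      (((m + 1 : ℕ) : ℂ) + n * k) L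
    have hL : ‖L‖ ≤ ‖pairingL y‖ * ‖φ‖ := by
      rw [ContinuousLinearMap.uncurryLeft_norm]
      refine ContinuousLinearMap.opNorm_le_bound _ (by positivity) fun v => ?_
      rw [ContinuousLinearMap.smulRight_apply, norm_smul, mul_right_comm]
      gcongr
      exact (pairingL y).le_opNorm v
    refine ⟨ψ, hψ.trans ?_, fun x => ?_⟩
    · refine (mul_le_mul (hδ (m + 1) m.succ_pos)
        (hL.trans (mul_le_mul_of_nonneg_left hφ (norm_nonneg _))) (norm_nonneg _) ?_).trans_eq ?_
      · refine le_trans ?_ (hδ (m + 1) m.succ_pos)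
        unfold resolventBound
        positivity
      · rw [Nat.factorial_succ, pow_succ]
        push_cast
        field_simp
    · rw [hψ', dunklTerm]
      congr 1
      funext x
      simp only [ContinuousLinearMap.uncurryLeft_apply, L]
      simp only [ContinuousLinearMap.smulRight_apply, pairingL_apply, hφ']
      rfl

variable (n k) in
/-- The Dunkl kernel as the sum of its homogeneous components. -/
def dunklSeries (x : Plane) (y : CPlane) : ℂ := ∑' m, dunklTerm n k y m x

lemma analyticOnNhd_dunklSeries
    (hδ : ∀ m : ℕ, 1 ≤ m → resolventBound n k (m + n * k) ≤ δ / m) (y : CPlane) :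
    AnalyticOnNhd ℝ (fun x => dunklSeries n k x y) Set.univ := by
  choose φ hφ hφ' using exists_multilinear_dunklTerm hδ y
  let p : FormalMultilinearSeries ℝ Plane ℂ := φ
  have hp : p.radius = ⊤ := by
    refine p.radius_eq_top_of_summable_norm fun r => ?_
    refine Summable.of_nonneg_of_le (fun m => by positivity) (fun m => ?_)
      (Real.summable_pow_div_factorial (δ * ‖pairingL y‖ * r))
    rw [mul_pow _ (r : ℝ), mul_div_right_comm]
    gcongr
    exact hφ m
  have h := (p.hasFPowerSeriesOnBall (by rw [hp]; exact ENNReal.zero_lt_top)).analyticOnNhd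
  have e : p.sum = fun x => dunklSeries n k x y := by
    funext x
    exact tsum_congr fun m => (hφ' m x).symm
  rw [hp, e] at h
  simpa using h

lemma norm_fderiv_multilinear_le {m : ℕ} (φ : Plane [×m]→L[ℝ] ℂ) (x : Plane) :
    ‖fderiv ℝ (fun x => φ fun _ => x) x‖ ≤ ‖φ‖ * (m * ‖x‖ ^ (m - 1)) := by
  have h : HasFDerivAt (fun x => φ fun _ => x) _ x :=
    (φ.hasFDerivAt (fun _ => x)).comp x
      (ContinuousLinearMap.pi fun _ : Fin m => ContinuousLinearMap.id ℝ Plane).hasFDerivAt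
  rw [h.fderiv]
  refine ContinuousLinearMap.opNorm_le_bound _ (by positivity) fun v => ?_
  simp only [ContinuousLinearMap.comp_apply, ContinuousMultilinearMap.linearDeriv_apply]
  refine (norm_sum_le_of_le _ fun i _ => φ.le_opNorm _).trans_eq ?_
  have e : ∀ i : Fin m, ∏ j, ‖Function.update (fun _ => x) i v j‖ = ‖v‖ * ‖x‖ ^ (m - 1) := by
    intro i
    have : ∀ j, ‖Function.update (fun _ => x) i v j‖ = Function.update (fun _ => ‖x‖) i ‖v‖ j :=
      fun j => by
        by_cases hj : j = i
        · subst hj; simp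
        · simp [hj]
    simp only [this]
    rw [Finset.prod_update_of_mem (Finset.mem_univ i)]
    simp [Finset.card_sdiff]
  simp [e]
  ring

lemma hasSum_dunklTerm (hδ : ∀ m : ℕ, 1 ≤ m → resolventBound n k (m + n * k) ≤ δ / m)
    (x : Plane) (y : CPlane) :
    HasSum (fun m => dunklTerm n k y m x) (dunklSeries n k x y) :=
  (Summable.of_norm_bounded (Real.summable_pow_div_factorial _)
    fun m => norm_dunklTerm_le hδ y m x).hasSum

lemma norm_dunklSeries_le (hδ : ∀ m : ℕ, 1 ≤ m → resolventBound n k (m + n * k) ≤ δ / m)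
    (x : Plane) (y : CPlane) : ‖dunklSeries n k x y‖ ≤ Real.exp (δ * orbitMax n x y) := by
  have h := NormedSpace.expSeries_div_hasSum_exp (δ * orbitMax n x y)
  rw [← Real.exp_eq_exp_ℝ] at h
  exact tsum_of_norm_bounded h fun m => norm_dunklTerm_le hδ y m x

lemma hasSum_fderiv_dunklTerm
    (hδ : ∀ m : ℕ, 1 ≤ m → resolventBound n k (m + n * k) ≤ δ / m) (x ξ : Plane) (y : CPlane) :
    HasSum (fun m => fderiv ℝ (dunklTerm n k y m) x ξ)
      (fderiv ℝ (fun x => dunklSeries n k x y) x ξ) := by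
  choose φ hφ hφ' using exists_multilinear_dunklTerm hδ y
  have hd : ∀ m, Differentiable ℝ (dunklTerm n k y m) := fun m =>
    differentiable_of_mem_homog (dunklTerm_mem_homog y m)
  set A := δ * ‖pairingL y‖
  set R := ‖x‖ + 1
  have hA : 0 ≤ A := by simpa using (norm_nonneg _).trans (hφ 1)
  -- Majorant of the derivatives on the ball of radius `R`; at `m = 0` the factor `m` makes the
  -- truncated exponent harmless.
  let u : ℕ → ℝ := fun m => A ^ m / m.factorial * (m * R ^ (m - 1))
  have hu : Summable u := by
    rw [← summable_nat_add_iff 1]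
    refine ((Real.summable_pow_div_factorial (A * R)).mul_left A).congr fun m => ?_
    simp only [u, Nat.factorial_succ, add_tsub_cancel_right]
    push_cast
    rw [mul_pow, pow_succ]
    field_simp
  have hb : ∀ m, ∀ z ∈ Metric.ball (0 : Plane) R, ‖fderiv ℝ (dunklTerm n k y m) z‖ ≤ u m := by
    intro m z hz
    rw [mem_ball_zero_iff] at hz
    rw [show dunklTerm n k y m = fun x => φ m fun _ => x from funext (hφ' m)]
    refine (norm_fderiv_multilinear_le (φ m) z).trans ?_
    refine mul_le_mul (hφ m) ?_ (by positivity) (by positivity)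
    gcongr
  have hx : x ∈ Metric.ball (0 : Plane) R := by
    rw [mem_ball_zero_iff]
    exact lt_add_one _
  have h := hasFDerivAt_tsum_of_isPreconnected hu Metric.isOpen_ball
    (convex_ball (0 : Plane) R).isPreconnected (fun m z _ => (hd m z).hasFDerivAt) hb hx
    (hasSum_dunklTerm hδ x y).summable hx
  have hs : Summable fun m => fderiv ℝ (dunklTerm n k y m) x :=
    Summable.of_norm_bounded hu fun m => hb m x hx
  have h' : HasFDerivAt (fun x => dunklSeries n k x y) (∑' m, fderiv ℝ (dunklTerm n k y m) x) x :=
    h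
  rw [h'.fderiv]
  exact (ContinuousLinearMap.apply ℝ ℂ ξ).hasSum hs.hasSum

/-- On a reflection line the difference quotient is a derivative, so termwise differentiation covers
both of its cases. -/
lemma hasSum_dunklOp_dunklTerm
    (hδ : ∀ m : ℕ, 1 ≤ m → resolventBound n k (m + n * k) ≤ δ / m) (x ξ : Plane) (y : CPlane) :
    HasSum (fun m => dunklOp n k ξ (dunklTerm n k y m) x)
      (dunklOp n k ξ (fun x => dunklSeries n k x y) x) := by
  simp only [dunklOp_eq]
  refine (hasSum_fderiv_dunklTerm hδ x ξ y).add
    ((hasSum_sum fun a _ => HasSum.mul_left _ ?_).mul_left k)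
  simp only [diffQuot_zroot]
  split_ifs
  · exact (hasSum_fderiv_dunklTerm hδ x _ y).mul_left 2
  · exact ((hasSum_dunklTerm hδ x y).sub (hasSum_dunklTerm hδ _ y)).div_const _

lemma isDunklKernel_dunklSeries (hk : ∀ m : ℕ, 1 ≤ m → (n : ℂ) * k ≠ -(m : ℂ) / 2) :
    IsDunklKernel n k (dunklSeries n k) := by
  obtain ⟨δ, -, hδ⟩ := exists_resolventBound_le n k
  refine ⟨analyticOnNhd_dunklSeries hδ, fun y => ?_, fun y ξ x => ?_⟩
  · refine (hasSum_dunklTerm hδ 0 y).unique ?_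
    refine (hasSum_single (f := fun m => dunklTerm n k y m 0) 0 fun m hm => ?_)
    obtain ⟨m, rfl⟩ := Nat.exists_eq_succ_of_ne_zero hm
    simp [dunklTerm, resolvent, pairing]
  -- `T_ξ` kills the constant term; dropping it shifts the series by one degree.
  · have h := (hasSum_nat_add_iff' 1).2 (hasSum_dunklOp_dunklTerm hδ x ξ y)
    simp only [Finset.sum_range_one, dunklOp_dunklTerm_zero, sub_zero,
      dunklOp_dunklTerm_succ hk] at h
    exact h.unique ((hasSum_dunklTerm hδ x y).mul_left _)

end Series

/-! ### Uniqueness through Taylor coefficients along rays -/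

section Uniqueness

lemma iteratedDeriv_succ_id_smul_zero (m : ℕ) {u : ℝ → ℂ} (hu : ContDiff ℝ ⊤ u) :
    iteratedDeriv (m + 1) (fun t => t • u t) 0 = (m + 1) * iteratedDeriv m u 0 := by
  have hd : ∀ {u : ℝ → ℂ}, ContDiff ℝ ⊤ u →
      deriv (fun t : ℝ => t • u t) = fun t => u t + t • deriv u t := by
    intro u hu
    funext t
    have h := ((hasDerivAt_id t).smul (hu.differentiable (by simp) t).hasDerivAt).deriv
    refine Eq.trans h ?_
    simp [add_comm]
  induction m generalizing u with
  | zero =>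
    rw [iteratedDeriv_succ', hd hu]
    simp
  | succ m ih =>
    have hu' : ContDiff ℝ ⊤ (deriv u) := hu.deriv'
    have hs : ContDiff ℝ ⊤ (fun t => t • deriv u t) := contDiff_id.smul hu'
    rw [iteratedDeriv_succ', hd hu, iteratedDeriv_fun_add (hu.of_le le_top).contDiffAt
      (hs.of_le le_top).contDiffAt, ih hu', ← iteratedDeriv_succ']
    push_cast
    ring

variable {n : ℕ} {k : ℂ} [NeZero n]

/-- Along `t ↦ t x` the equation becomes an Euler-type equation. Differentiating it `m + 1` times at
`t = 0` puts the Taylor coefficient of that order, as a function of `x`, in the kernel of `(m + 1 +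
nk) - kA`, provided the previous coefficient vanishes. -/
lemma eq_zero_of_radial (hk : ∀ m : ℕ, 1 ≤ m → (n : ℂ) * k ≠ -(m : ℂ) / 2) (y : CPlane)
    {f : Plane → ℂ} (hf : AnalyticOnNhd ℝ f Set.univ) (h0 : f 0 = 0)
    (h : ∀ x, fderiv ℝ f x x + k * ∑ a, (f x - f (refl n a x)) = pairing x y * f x) (x : Plane) :
    f x = 0 := by
  have ha : ∀ x, AnalyticOnNhd ℝ (fun t : ℝ => f (t • x)) Set.univ := fun x t _ =>
    AnalyticAt.fun_comp (g := f) (f := fun t : ℝ => t • x) (hf (t • x) (Set.mem_univ _))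
      (analyticAt_id.smul analyticAt_const)
  have hc : ∀ x, ContDiff ℝ ⊤ (fun t : ℝ => f (t • x)) := fun x =>
    contDiff_iff_contDiffAt.2 fun t => (ha x t (Set.mem_univ _)).contDiffAt
  have hode : ∀ x, (fun t : ℝ => t • deriv (fun t : ℝ => f (t • x)) t) = fun t : ℝ =>
      pairing x y * (t • f (t • x)) - k * ∑ a, (f (t • x) - f (t • refl n a x)) := by
    intro x
    funext t
    have hd : deriv (fun t : ℝ => f (t • x)) t = fderiv ℝ f (t • x) x := by
      have := (hf (t • x) (Set.mem_univ _)).differentiableAt.hasFDerivAt.comp_hasDerivAt t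
        ((hasDerivAt_id t).smul_const x)
      simpa [Function.comp_def] using this.deriv
    have h1 := h (t • x)
    simp only [map_smul, pairing_smul, Complex.real_smul] at h1
    rw [hd]
    simp only [Complex.real_smul]
    linear_combination h1
  have hz : ∀ m x, iteratedDeriv m (fun t : ℝ => f (t • x)) 0 = 0 := by
    intro m
    induction m with
    | zero => simp [h0]
    | succ m ih =>
      refine eq_zero_of_mul_eq_sum (r := fun a => refl n a) refl_refl_refl
        (natCast_add_ne_zero hk m.succ_pos) (natCast_add_sq_ne hk m.succ_pos) fun x => ?_
      have hc' : ∀ x, ContDiffAt ℝ ((m + 1 : ℕ) : WithTop ℕ∞) (fun t : ℝ => f (t • x)) 0 :=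
        fun x => ((hc x).of_le le_top).contDiffAt
      have h1 := congrArg (fun u => iteratedDeriv (m + 1) u 0) (hode x)
      rw [iteratedDeriv_succ_id_smul_zero m (hc x).deriv', ← iteratedDeriv_succ'] at h1
      have e1 : ContDiffAt ℝ ((m + 1 : ℕ) : WithTop ℕ∞) (fun t : ℝ => t • f (t • x)) 0 :=
        contDiffAt_id.smul (hc' x)
      have e2 : ∀ a, ContDiffAt ℝ ((m + 1 : ℕ) : WithTop ℕ∞)
        (fun t : ℝ => f (t • x) - f (t • refl n a x)) 0 := fun a => (hc' x).sub (hc' _)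
      rw [iteratedDeriv_fun_sub (contDiffAt_const.mul e1)
        (contDiffAt_const.mul (ContDiffAt.sum fun a _ => e2 a)),
        iteratedDeriv_const_mul_field, iteratedDeriv_const_mul_field,
        iteratedDeriv_succ_id_smul_zero m (hc x), ih,
        iteratedDeriv_fun_sum fun a _ => e2 a] at h1
      simp only [fun a => iteratedDeriv_fun_sub (hc' x) (hc' (refl n a x))] at h1
      rw [Finset.sum_sub_distrib, Finset.sum_const, Finset.card_univ, ZMod.card,
        nsmul_eq_mul] at h1
      push_cast
      linear_combination h1
  -- All Taylor coefficients vanish, so the identity theorem on the line gives zero, and `t = 1`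
  -- recovers `f x`.
  have htop : analyticOrderAt (fun t : ℝ => f (t • x)) 0 = ⊤ := by
    refine ENat.eq_top_iff_forall_ge.2 fun m => ?_
    exact (natCast_le_analyticOrderAt_iff_iteratedDeriv_eq_zero (ha x 0 (Set.mem_univ _))).2
      fun i _ => hz i x
  have := (ha x).eqOn_zero_of_preconnected_of_eventuallyEq_zero isPreconnected_univ
    (Set.mem_univ 0) (analyticOrderAt_eq_top.1 htop) (Set.mem_univ 1)
  simpa using this

lemma IsDunklKernel.eq (hk : ∀ m : ℕ, 1 ≤ m → (n : ℂ) * k ≠ -(m : ℂ) / 2)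
    {E F : Plane → CPlane → ℂ} (hE : IsDunklKernel n k E) (hF : IsDunklKernel n k F) : E = F := by
  funext x y
  refine sub_eq_zero.1 (eq_zero_of_radial hk y (f := fun x => E x y - F x y)
    ((hE.analytic y).sub (hF.analytic y)) (by simp [hE.map_zero, hF.map_zero]) (fun x => ?_) x)
  have hE' := (hE.analytic y x (Set.mem_univ x)).differentiableAt
  have hF' := (hF.analytic y x (Set.mem_univ x)).differentiableAt
  rw [← dunklOp_self (fun x => E x y - F x y), dunklOp_sub x hE' hF', hE.eigen, hF.eigen, mul_sub]

end Uniqueness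

end DihedralDunkl

end

theorem mainTheorem4 (n : ℕ) (hn : 2 ≤ n) (k : ℂ)
    (hk : ∀ m : ℕ, 1 ≤ m → (n : ℂ) * k ≠ -(m : ℂ) / 2)
    (ν : ℕ) (hν : 0 < ν) (hre : -(ν : ℝ) < ((n : ℂ) * k).re) :
    (∃! E : DihedralDunkl.Plane → DihedralDunkl.CPlane → ℂ,
        DihedralDunkl.IsDunklKernel n k E) ∧
    ∃ δ : ℝ, 1 ≤ δ ∧ ∃ C : ℝ, 0 < C ∧
      ∀ (x : DihedralDunkl.Plane) (y : DihedralDunkl.CPlane),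
        ‖DihedralDunkl.dunklKernel n k x y‖ ≤
          C * (δ * DihedralDunkl.orbitMax n x y + 1) ^ (ν + 2) *
            Real.exp (δ * DihedralDunkl.orbitMax n x y) := by
  have : NeZero n := ⟨by omega⟩
  have hS := DihedralDunkl.isDunklKernel_dunklSeries hk
  have hE : DihedralDunkl.dunklKernel n k = DihedralDunkl.dunklSeries n k :=
    -- Existence makes the chosen kernel a solution, and uniqueness identifies it with the series.
    (Classical.epsilon_spec ⟨_, hS⟩ : DihedralDunkl.IsDunklKernel n k _).eq hk hS
  refine ⟨⟨_, hS, fun F hF => hF.eq hk hS⟩, ?_⟩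
  obtain ⟨δ, hδ1, hδ⟩ := DihedralDunkl.exists_resolventBound_le n k
  refine ⟨δ, hδ1, 1, one_pos, fun x y => ?_⟩
  rw [hE, one_mul]
  refine (DihedralDunkl.norm_dunklSeries_le hδ x y).trans
    (le_mul_of_one_le_left (Real.exp_pos _).le (one_le_pow₀ ?_))
  have := DihedralDunkl.orbitMax_nonneg (n := n) x y
  nlinarith
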